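/- Let $n,k\ge 1$ be integers, $0<\mu\le L$ and $\kappa=L/\mu$. Let $C_{\mu,L}$ be a class of functions $f:\mathbb{R}^n\to\mathbb{R}$ such that: every $f\in C_{\mu,L}$ is differentiable with Lipschitz-continuous gradient, has a local minimum at the origin with $f(0)=0$, is twice continuously differentiable in a neighborhood of the origin, and its Hessian at the origin has spectrum contained in $[\mu,L]$; every $\lambda\in[\mu,L]$ lies in the spectrum of the Hessian at the origin of some member of $C_{\mu,L}$; and $f\circ T\in C_{\mu,L}$ for all $f\in C_{\mu,L}$ and all orthogonal $T$. For $1\le j\le k-1$ let $$h_j=\kappa^{j/k}\binom{k-1}{j},\qquad g_j=\frac{1}{\kappa^{(k-j)/k}}\binom{k}{j}-\frac{h_j}{\kappa}.$$ For $f\in C_{\mu,L}$ consider, for $t\ge0$, the dynamical system $$x^{(k)}(t)=-\sum_{j=1}^{k-1}g_j\,x^{(j)}(t)-\frac1L\nabla f\Big(x(t)+\sum_{j=1}^{k-1}h_j\,x^{(j)}(t)\Big)\qquad(\ast)$$ with state $z=(x,\dot x,\dots,x^{(k-1)})$, and the sector condition $$\Big(\tfrac1L\nabla f(x)-\alpha_{\mathrm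 s}x\Big)^{\!\top}\Big(\tfrac1L\nabla f(x)-x\Big)\le0\quad\text{for all }x\in\mathbb{R}^n.\qquad(\ast\ast)$$ 1. If $(\ast\ast)$ holds for some $\alpha_{\mathrm s}>0$, then the origin is a globally asymptotically stable equilibrium of $(\ast)$ in the sense of Lyapunov (and a solution of $(\ast)$ on $[0,\infty)$ exists for every initial state). 2. If $(\ast\ast)$ holds with $\alpha_{\mathrm s}=1/\kappa$, then the trajectories of $(\ast)$ converge to the origin with exponential rate $1/\kappa^{1/k}$, in the sense that for every $r<1/\kappa^{1/k}$ there is $c\ge1$ such that every solution satisfies $|z(t)|\le c\,|z(0)|\,e^{-rt}$ for all $t\ge0$. More precisely, there is $c\ge1$ such that every solution satisfies $|z(t)|\le c\,|z(0)|\,(1+t)^{k-1}e^{-t/\kappa^{1/k}}$ for all $t\ge 0$. 3. If $f\in C_{\mu,L}$ is $\mu$-strongly convex and has an $L$-Lipschitz gradient, then $(\ast\ast)$ holds with $\alpha_{\mathrm s}=1/\kappa$. -/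

import Mathlib

namespace GradAlg

/-- The Hessian of `f` at `x`, as the derivative of the gradient. -/
noncomputable def hessian {n : ℕ} (f : EuclideanSpace ℝ (Fin n) → ℝ)
    (x : EuclideanSpace ℝ (Fin n)) :
    EuclideanSpace ℝ (Fin n) →L[ℝ] EuclideanSpace ℝ (Fin n) :=
  fderiv ℝ (gradient f) x

/-- `C` is an admissible class of objective functions with curvature bounds `μ`, `L`:
its members have Lipschitz gradients and a local minimum with value `0` at the origin, are twice
continuously differentiable near the origin, and have a Hessian at the origin with spectrum in
`[μ, L]`; every point of `[μ, L]` is attained as such a spectral value; and `C` is invariant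
under orthogonal transformations of the argument. -/
structure IsFunctionClass {n : ℕ} (μ L : ℝ) (C : Set (EuclideanSpace ℝ (Fin n) → ℝ)) : Prop where
  differentiable : ∀ f ∈ C, Differentiable ℝ f
  lipschitz_gradient : ∀ f ∈ C, ∃ K, LipschitzWith K (gradient f)
  isLocalMin_zero : ∀ f ∈ C, IsLocalMin f 0
  map_zero : ∀ f ∈ C, f 0 = 0
  contDiffAt_zero : ∀ f ∈ C, ContDiffAt ℝ 2 f 0
  spectrum_subset : ∀ f ∈ C, spectrum ℝ (hessian f 0) ⊆ Set.Icc μ L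
  spectrum_attained : ∀ lam ∈ Set.Icc μ L, ∃ f ∈ C, lam ∈ spectrum ℝ (hessian f 0)
  comp_orthogonal : ∀ f ∈ C,
    ∀ T : EuclideanSpace ℝ (Fin n) ≃ₗᵢ[ℝ] EuclideanSpace ℝ (Fin n), f ∘ T ∈ C

/-- `∇f / L` lies in the sector `[α, 1]`. -/
def SectorCondition {n : ℕ} (L α : ℝ) (f : EuclideanSpace ℝ (Fin n) → ℝ) : Prop :=
  ∀ x, inner ℝ ((1 / L) • gradient f x - α • x) ((1 / L) • gradient f x - x) ≤ 0

/-- `h_j = κ^(j/k) * binom(k-1, j)`. -/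
noncomputable def hCoeff (κ : ℝ) (k j : ℕ) : ℝ :=
  κ ^ ((j : ℝ) / (k : ℝ)) * (Nat.choose (k - 1) j : ℝ)

/-- `g_j = κ^(-(k-j)/k) * binom(k, j) - h_j / κ`. -/
noncomputable def gCoeff (κ : ℝ) (k j : ℕ) : ℝ :=
  1 / κ ^ (((k : ℝ) - (j : ℝ)) / (k : ℝ)) * (Nat.choose k j : ℝ) - hCoeff κ k j / κ

/-- The `j`-th time derivative of a trajectory on `[0, ∞)` (one-sided at time `0`). -/
noncomputable def timeDeriv {n : ℕ} (j : ℕ) (x : ℝ → EuclideanSpace ℝ (Fin n)) (t : ℝ) :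
    EuclideanSpace ℝ (Fin n) :=
  iteratedDerivWithin j x (Set.Ici 0) t

/-- `x` solves, on `[0, ∞)`, the `k`-th order equation
`x⁽ᵏ⁾ = - ∑ g_j x⁽ʲ⁾ - ∇f (x + ∑ h_j x⁽ʲ⁾) / L`, the sums being over `1 ≤ j ≤ k - 1`. -/
def IsSolution {n : ℕ} (κ L : ℝ) (k : ℕ) (f : EuclideanSpace ℝ (Fin n) → ℝ)
    (x : ℝ → EuclideanSpace ℝ (Fin n)) : Prop :=
  ContDiffOn ℝ (k : WithTop ℕ∞) x (Set.Ici 0) ∧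
    ∀ t : ℝ, 0 ≤ t →
      timeDeriv k x t =
        - (∑ j ∈ Finset.Icc 1 (k - 1), gCoeff κ k j • timeDeriv j x t)
        - (1 / L) • gradient f
            (x t + ∑ j ∈ Finset.Icc 1 (k - 1), hCoeff κ k j • timeDeriv j x t)

/-- The state `z(t) = (x(t), ẋ(t), …, x⁽ᵏ⁻¹⁾(t))`; its norm is the largest Euclidean norm of a
component, which is equivalent to the Euclidean norm of the whole vector. -/
noncomputable def state {n : ℕ} (k : ℕ) (x : ℝ → EuclideanSpace ℝ (Fin n)) (t : ℝ) :
    Fin k → EuclideanSpace ℝ (Fin n) :=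
  fun j => timeDeriv (j : ℕ) x t

/-- The origin of the state space is a globally asymptotically stable equilibrium, in the sense
of Lyapunov; solutions on `[0, ∞)` through every initial state are part of the notion. -/
structure OriginGloballyAsymptoticallyStable {n : ℕ} (κ L : ℝ) (k : ℕ)
    (f : EuclideanSpace ℝ (Fin n) → ℝ) : Prop where
  exists_solution : ∀ z₀ : Fin k → EuclideanSpace ℝ (Fin n),
    ∃ x, IsSolution κ L k f x ∧ state k x 0 = z₀
  equilibrium : IsSolution κ L k f (fun _ => 0)
  stable : ∀ ε : ℝ, 0 < ε → ∃ δ : ℝ, 0 < δ ∧ ∀ x, IsSolution κ L k f x →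
    ‖state k x 0‖ < δ → ∀ t : ℝ, 0 ≤ t → ‖state k x t‖ < ε
  attractive : ∀ x, IsSolution κ L k f x →
    Filter.Tendsto (state k x) Filter.atTop (nhds 0)

/-- All trajectories converge to the origin with exponential rate `ρ`. The rate is meant as an
exponent, as it is read off from the real parts of characteristic roots: any `r < ρ` gives a
uniform exponential estimate. -/
def ConvergesWithRate {n : ℕ} (κ L : ℝ) (k : ℕ) (f : EuclideanSpace ℝ (Fin n) → ℝ)
    (ρ : ℝ) : Prop :=
  ∀ r : ℝ, r < ρ → ∃ c : ℝ, 1 ≤ c ∧ ∀ x, IsSolution κ L k f x → ∀ t : ℝ, 0 ≤ t →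
    ‖state k x t‖ ≤ c * ‖state k x 0‖ * Real.exp (-r * t)

end GradAlg

open Set Metric in
/-- A Lipschitz vector field has integral curves whose time of existence depends only on the
Lipschitz constant. -/
theorem exists_integralCurve_Icc_of_lipschitz {E : Type*} [NormedAddCommGroup E] [NormedSpace ℝ E]
    [CompleteSpace E] {F : E → E} {K : NNReal} (hF : LipschitzWith K F) (t₀ : ℝ) (z₀ : E) :
    ∃ γ : ℝ → E, γ t₀ = z₀ ∧ ∀ t ∈ Icc t₀ (t₀ + 1 / (K + 1)),
      HasDerivWithinAt γ (F (γ t)) (Icc t₀ (t₀ + 1 / (K + 1))) t := by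
  have hε : (0 : ℝ) < 1 / (K + 1) := by positivity
  -- On the ball of radius a = ‖F z₀‖ about z₀ the speed is at most K a + ‖F z₀‖ = (K + 1) a, so a
  -- curve stays in it for time 1 / (K + 1), whatever z₀ is.
  refine IsPicardLindelof.exists_eq_forall_mem_Icc_hasDerivWithinAt₀
    (f := fun _ => F) (t₀ := ⟨t₀, left_mem_Icc.2 (by linarith)⟩) (a := ‖F z₀‖₊)
    (L := (K + 1) * ‖F z₀‖₊) (K := K)
    (IsPicardLindelof.of_time_independent ?_ hF.lipschitzOnWith ?_)
  · intro x hx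
    have h1 := hF.dist_le_mul x z₀
    rw [mem_closedBall] at hx
    have h2 : ‖F x‖ ≤ dist (F x) (F z₀) + ‖F z₀‖ := by
      rw [dist_eq_norm]; simpa using norm_add_le (F x - F z₀) (F z₀)
    have h3 : (K : ℝ) * dist x z₀ ≤ K * ‖F z₀‖ := by
      gcongr; simpa using hx
    push_cast
    linarith
  · have : max (t₀ + 1 / ((K : ℝ) + 1) - t₀) (t₀ - t₀) = 1 / (K + 1) := by
      rw [add_sub_cancel_left, sub_self, max_eq_left hε.le]
    simp only [this]
    push_cast
    rw [sub_zero]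
    apply le_of_eq
    field_simp

open Set in
/-- Concatenation of integral curves. -/
theorem HasDerivWithinAt.piecewise_integralCurve {E : Type*} [NormedAddCommGroup E]
    [NormedSpace ℝ E] {F : E → E} {a b c : ℝ} (hab : a ≤ b) (hbc : b ≤ c) {γ δ : ℝ → E}
    (hγ : ∀ t ∈ Icc a b, HasDerivWithinAt γ (F (γ t)) (Icc a b) t)
    (hδ : ∀ t ∈ Icc b c, HasDerivWithinAt δ (F (δ t)) (Icc b c) t) (h : γ b = δ b) :
    ∀ t ∈ Icc a c, HasDerivWithinAt (fun s => if s ≤ b then γ s else δ s)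
      (F (if t ≤ b then γ t else δ t)) (Icc a c) t := by
  intro t ht
  have hl : ∀ s ∈ Icc a b, (if s ≤ b then γ s else δ s) = γ s := fun s hs => if_pos hs.2
  have hr : ∀ s ∈ Icc b c, (if s ≤ b then γ s else δ s) = δ s := by
    intro s hs
    split_ifs with hsb
    · rw [le_antisymm hsb hs.1, h]
    · rfl
  rw [← Icc_union_Icc_eq_Icc hab hbc]
  apply HasDerivWithinAt.union
  · by_cases htb : t ∈ Icc a b
    · rw [hl t htb]
      exact (hγ t htb).congr hl (hl t htb)
    · exact HasFDerivWithinAt.of_notMem_closure (by rwa [isClosed_Icc.closure_eq])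
  · by_cases htb : t ∈ Icc b c
    · rw [hr t htb]
      exact (hδ t htb).congr hr (hr t htb)
    · exact HasFDerivWithinAt.of_notMem_closure (by rwa [isClosed_Icc.closure_eq])

open Set in
/-- A Lipschitz vector field has integral curves on `[0, ∞)`. -/
theorem exists_integralCurve_Ici_of_lipschitz {E : Type*} [NormedAddCommGroup E] [NormedSpace ℝ E]
    [CompleteSpace E] {F : E → E} {K : NNReal} (hF : LipschitzWith K F) (z₀ : E) :
    ∃ γ : ℝ → E, γ 0 = z₀ ∧ ∀ t ∈ Ici (0 : ℝ), HasDerivWithinAt γ (F (γ t)) (Ici 0) t := by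
  set ε : ℝ := 1 / (K + 1) with hε
  have hε0 : 0 < ε := by positivity
  have key : ∀ m : ℕ, ∃ γ : ℝ → E, γ 0 = z₀ ∧
      ∀ t ∈ Icc (0 : ℝ) (m * ε), HasDerivWithinAt γ (F (γ t)) (Icc 0 (m * ε)) t := by
    intro m
    induction m with
    | zero =>
      refine ⟨fun _ => z₀, rfl, fun t _ => ?_⟩
      have : Icc (0 : ℝ) ((0 : ℕ) * ε) = {0} := by simp
      rw [this]
      exact HasFDerivWithinAt.of_subsingleton subsingleton_singleton
    | succ m ih =>
      obtain ⟨γ, h0, hγ⟩ := ih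
      obtain ⟨δ, hδ0, hδ⟩ := exists_integralCurve_Icc_of_lipschitz hF (m * ε) (γ (m * ε))
      have hm : (0 : ℝ) ≤ m * ε := by positivity
      refine ⟨fun s => if s ≤ m * ε then γ s else δ s, by simp only [if_pos hm, h0], ?_⟩
      have e : ((m + 1 : ℕ) : ℝ) * ε = m * ε + ε := by push_cast; ring
      rw [e]
      exact HasDerivWithinAt.piecewise_integralCurve hm (by linarith) hγ hδ hδ0.symm
  choose Γ h0 hΓ using key
  have huniq : ∀ m m' : ℕ, m ≤ m' → EqOn (Γ m) (Γ m') (Icc 0 (m * ε)) := by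
    intro m m' hm
    have hsub : Icc 0 (m * ε) ⊆ Icc 0 (m' * ε) := by
      apply Icc_subset_Icc_right
      gcongr
    have mem : ∀ t ∈ Ico 0 (m * ε), Icc 0 (m * ε) ∈ nhdsWithin t (Ici t) := fun t ht =>
      Filter.mem_of_superset (Icc_mem_nhdsGE ht.2) (Icc_subset_Icc_left ht.1)
    refine ODE_solution_unique_of_mem_Icc_right (v := fun _ => F) (s := fun _ => univ) (K := K)
      (fun _ _ => hF.lipschitzOnWith)
      (fun t ht => (hΓ m t ht).continuousWithinAt)
      (fun t ht => (hΓ m t (Ico_subset_Icc_self ht)).mono_of_mem_nhdsWithin (mem t ht))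
      (fun _ _ => mem_univ _)
      (fun t ht => ((hΓ m' t (hsub ht)).mono hsub).continuousWithinAt)
      (fun t ht => ((hΓ m' t (hsub (Ico_subset_Icc_self ht))).mono hsub).mono_of_mem_nhdsWithin
        (mem t ht))
      (fun _ _ => mem_univ _) ?_
    rw [h0, h0]
  -- The glued curve uses, at time t, the first interval [0, mε] that contains t; by uniqueness any
  -- later one gives the same value.
  have hglob : ∀ m : ℕ, EqOn (fun t => Γ ⌈t / ε⌉₊ t) (Γ m) (Icc 0 (m * ε)) := by
    intro m t ht
    have h1 : t ≤ ⌈t / ε⌉₊ * ε := by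
      rw [← div_le_iff₀ hε0]; exact Nat.le_ceil _
    have h2 : ⌈t / ε⌉₊ ≤ m := Nat.ceil_le.2 (by rw [div_le_iff₀ hε0]; exact ht.2)
    exact huniq _ _ h2 ⟨ht.1, h1⟩
  refine ⟨fun t => Γ ⌈t / ε⌉₊ t, by simp [h0], fun t ht => ?_⟩
  obtain ⟨m, hm⟩ := exists_nat_gt (t / ε)
  have hm' : t < m * ε := by rwa [div_lt_iff₀ hε0] at hm
  have htm : t ∈ Icc 0 (m * ε) := ⟨ht, hm'.le⟩
  have h1 : HasDerivWithinAt (fun t => Γ ⌈t / ε⌉₊ t) (F (Γ m t)) (Icc 0 (m * ε)) t :=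
    (hΓ m t htm).congr (hglob m) (hglob m htm)
  rw [← hglob m htm] at h1
  refine h1.mono_of_mem_nhdsWithin ?_
  rw [← Ici_inter_Iic, Set.inter_comm]
  exact Filter.inter_mem (mem_nhdsWithin_of_mem_nhds (Iic_mem_nhds hm')) self_mem_nhdsWithin

/-! ### Convexity, smoothness and co-coercivity. -/

open Set in
/-- A differentiable convex function lies above its tangent planes. -/
theorem ConvexOn.add_fderiv_le {E : Type*} [NormedAddCommGroup E] [InnerProductSpace ℝ E]
    {φ : E → ℝ} (hφ : ConvexOn ℝ univ φ) {φ' : E →L[ℝ] ℝ} {y : E} (h : HasFDerivAt φ φ' y)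
    (z : E) : φ y + φ' (z - y) ≤ φ z := by
  have hl : HasDerivAt (fun t : ℝ => φ (AffineMap.lineMap y z t)) (φ' (z - y)) 0 := by
    have h1 : HasDerivAt (fun t : ℝ => (AffineMap.lineMap y z t : E)) (z - y) 0 :=
      AffineMap.hasDerivAt_lineMap
    have h2 : HasFDerivAt φ φ' (AffineMap.lineMap y z (0 : ℝ)) := by simpa using h
    exact h2.comp_hasDerivAt (0 : ℝ) h1
  have hc : ConvexOn ℝ univ (fun t : ℝ => φ (AffineMap.lineMap y z t)) := by
    exact hφ.comp_affineMap (AffineMap.lineMap y z : ℝ →ᵃ[ℝ] E)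
  have := hc.le_slope_of_hasDerivAt (mem_univ 0) (mem_univ 1) zero_lt_one hl
  simp [slope_def_field] at this
  simp
  linarith

open Set in
/-- The descent lemma for functions with Lipschitz gradient. -/
theorem le_add_inner_gradient_add_sq {E : Type*} [NormedAddCommGroup E] [InnerProductSpace ℝ E]
    [CompleteSpace E] {f : E → ℝ} (hf : Differentiable ℝ f) {K : NNReal}
    (hK : LipschitzWith K (gradient f)) (y z : E) :
    f z ≤ f y + inner ℝ (gradient f y) (z - y) + K / 2 * ‖z - y‖ ^ 2 := by
  have hl : ∀ t : ℝ, HasDerivAt (fun t : ℝ => f (AffineMap.lineMap y z t))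
      (inner ℝ (gradient f (AffineMap.lineMap y z t)) (z - y)) t := by
    intro t
    have h1 : HasDerivAt (fun t : ℝ => (AffineMap.lineMap y z t : E)) (z - y) t :=
      AffineMap.hasDerivAt_lineMap
    have h2 := (hf (AffineMap.lineMap y z t)).hasFDerivAt
    have := h2.comp_hasDerivAt t h1
    rwa [← inner_gradient_left] at this
  have hB : ∀ t : ℝ, HasDerivAt
      (fun t : ℝ => f y + inner ℝ (gradient f y) (z - y) * t + K / 2 * ‖z - y‖ ^ 2 * t ^ 2)
      (inner ℝ (gradient f y) (z - y) + K * ‖z - y‖ ^ 2 * t) t := by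
    intro t
    have := (((hasDerivAt_id t).const_mul (inner ℝ (gradient f y) (z - y))).const_add (f y)).add
      (((hasDerivAt_id t).pow 2).const_mul (K / 2 * ‖z - y‖ ^ 2))
    refine this.congr_deriv ?_
    simp
    ring
  have := image_le_of_deriv_right_le_deriv_boundary (a := 0) (b := 1)
    (fun t _ => (hl t).continuousAt.continuousWithinAt) (fun t _ => (hl t).hasDerivWithinAt)
    (by simp) (fun t _ => (hB t).continuousAt.continuousWithinAt)
    (fun t _ => (hB t).hasDerivWithinAt) (fun t ht => ?_) (right_mem_Icc.2 zero_le_one)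
  · simpa using this
  · have h1 : inner ℝ (gradient f (AffineMap.lineMap y z t) - gradient f y) (z - y)
        ≤ (K * (t * ‖z - y‖)) * ‖z - y‖ := by
      refine (real_inner_le_norm _ _).trans ?_
      gcongr
      have := hK.dist_le_mul (AffineMap.lineMap y z t) y
      rw [dist_lineMap_left, dist_eq_norm, Real.norm_of_nonneg ht.1, dist_comm, dist_eq_norm] at this
      exact this
    rw [inner_sub_left] at h1
    linarith [h1]

/-- Co-coercivity of the gradient, at a pair of points one of which is critical: if `f` is
`μ`-strongly convex with `L`-Lipschitz gradient, `∇f` lies in the sector `[μ, L]`. -/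
theorem StrongConvexOn.inner_gradient_sub_le_zero {E : Type*} [NormedAddCommGroup E]
    [InnerProductSpace ℝ E] [CompleteSpace E] {f : E → ℝ} {μ : ℝ} {L : NNReal} (hμL : μ ≤ L)
    (hf : Differentiable ℝ f) (hc : StrongConvexOn Set.univ μ f)
    (hL : LipschitzWith L (gradient f)) (h0 : gradient f 0 = 0) (x : E) :
    inner ℝ (gradient f x - μ • x) (gradient f x - (L : ℝ) • x) ≤ 0 := by
  have hlow : ∀ y z, f y + inner ℝ (gradient f y) (z - y) + μ / 2 * ‖z - y‖ ^ 2 ≤ f z := by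
    intro y z
    have h1 := strongConvexOn_iff_convex.1 hc
    have h2 : HasFDerivAt (fun x => f x - μ / 2 * ‖x‖ ^ 2)
        (fderiv ℝ f y - (μ / 2) • (2 • (innerSL ℝ y))) y :=
      (hf y).hasFDerivAt.sub ((hasStrictFDerivAt_norm_sq y).hasFDerivAt.const_mul (μ / 2))
    have h3 := h1.add_fderiv_le h2 z
    have h4 : ‖z‖ ^ 2 = ‖y‖ ^ 2 + 2 * inner ℝ y (z - y) + ‖z - y‖ ^ 2 := by
      rw [← norm_add_sq_real, add_sub_cancel]
    simp only [sub_apply, smul_apply, innerSL_apply_apply,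
      ← inner_gradient_left, smul_eq_mul, nsmul_eq_mul, Nat.cast_ofNat] at h3
    rw [h4] at h3
    linarith
  have hup := le_add_inner_gradient_add_sq hf hL
  set g := gradient f x - μ • x with hg
  have hgx : gradient f x = g + μ • x := by rw [hg]; abel
  -- For φ = f - (μ/2)‖·‖², convex with g = ∇φ(x), a gradient step of length s from x must stay
  -- above φ(0), and the point s g must satisfy both the upper bound at 0 and the tangent bound at
  -- x. Adding these four inequalities eliminates all values of f.
  have key : ∀ s : ℝ, (2 * s - (L - μ) * s ^ 2) * ‖g‖ ^ 2 ≤ inner ℝ g x := by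
    intro s
    have a1 := hup x (x - s • g)
    have a2 := hlow 0 (x - s • g)
    have a3 := hup 0 (s • g)
    have a4 := hlow x (s • g)
    simp only [h0, inner_zero_left, sub_zero, sub_sub_cancel_left, hgx, inner_add_left,
      inner_sub_right, inner_neg_right, inner_smul_left, inner_smul_right, norm_neg,
      norm_sub_sq_real, norm_smul, mul_pow, Real.norm_eq_abs, sq_abs, real_inner_self_eq_norm_sq,
      real_inner_comm g x, conj_trivial] at a1 a2 a3 a4
    nlinarith [a1, a2, a3, a4]
  have hfin : ‖g‖ ^ 2 ≤ (L - μ) * inner ℝ g x := by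
    rcases hμL.eq_or_lt with h | h
    · rw [← h, sub_self, zero_mul]
      by_contra! hpos
      -- If L = μ the bound is linear in s; a large s contradicts g ≠ 0.
      have := key ((inner ℝ g x + 1) / ‖g‖ ^ 2)
      rw [← h, sub_self] at this
      have e : (2 * ((inner ℝ g x + 1) / ‖g‖ ^ 2) - 0 * ((inner ℝ g x + 1) / ‖g‖ ^ 2) ^ 2) * ‖g‖ ^ 2
          = 2 * (inner ℝ g x + 1) := by
        rw [zero_mul, sub_zero, mul_assoc, div_mul_cancel₀ _ hpos.ne']
      have h0 := key 0
      simp only [mul_zero, zero_mul, sub_self, ne_eq, OfNat.ofNat_ne_zero, not_false_eq_true,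
        zero_pow] at h0
      linarith
    · have hd : 0 < (L : ℝ) - μ := sub_pos.2 h
      -- This s maximizes the quadratic in `key`.
      have := key (1 / (L - μ))
      have e : (2 * (1 / ((L : ℝ) - μ)) - (L - μ) * (1 / (L - μ)) ^ 2) * ‖g‖ ^ 2
          = ‖g‖ ^ 2 / (L - μ) := by
        field_simp
        ring
      rw [e, div_le_iff₀ hd] at this
      linarith
  have e : gradient f x - (L : ℝ) • x = g - ((L : ℝ) - μ) • x := by
    rw [hgx, sub_smul]; abel
  rw [e, inner_sub_right, inner_smul_right, real_inner_self_eq_norm_sq]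
  linarith

namespace GradAlg

theorem sectorCondition_of_strongConvexOn {n : ℕ} {μ L κ : ℝ} (hμ : 0 < μ) (hμL : μ ≤ L)
    (hκ : κ = L / μ) {f : EuclideanSpace ℝ (Fin n) → ℝ} (hf : Differentiable ℝ f)
    (h0 : gradient f 0 = 0) (hc : StrongConvexOn Set.univ μ f)
    (hL : LipschitzWith L.toNNReal (gradient f)) : SectorCondition L (1 / κ) f := by
  intro x
  have hL0 : 0 < L := hμ.trans_le hμL
  have hco : (L.toNNReal : ℝ) = L := Real.coe_toNNReal _ hL0.le
  have h := hc.inner_gradient_sub_le_zero (by rwa [hco]) hf hL h0 x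
  rw [hco] at h
  have e1 : (1 / L) • gradient f x - (1 / κ) • x = (1 / L) • (gradient f x - μ • x) := by
    rw [smul_sub, smul_smul, hκ]
    congr 2
    field_simp
  have e2 : (1 / L) • gradient f x - x = (1 / L) • (gradient f x - L • x) := by
    rw [smul_sub, smul_smul, one_div_mul_cancel hL0.ne', one_smul]
  rw [e1, e2, inner_smul_left, inner_smul_right, conj_trivial]
  have : 0 < 1 / L := by positivity
  exact mul_nonpos_of_nonneg_of_nonpos this.le (mul_nonpos_of_nonneg_of_nonpos this.le h)

end GradAlg

/-! ### Decay of the gradient flow and of a first-order lag. -/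

namespace GradAlg

open Set in
/-- Exponential decay of `y` under `ẏ = -u` if `u` is strongly monotone along the trajectory. -/
theorem norm_le_exp_of_inner_ge {E : Type*} [NormedAddCommGroup E] [InnerProductSpace ℝ E]
    {y u : ℝ → E} {ρ : ℝ} (hy : ∀ t ∈ Ici (0 : ℝ), HasDerivWithinAt y (-u t) (Ici 0) t)
    (hu : ∀ t ∈ Ici (0 : ℝ), ρ * ‖y t‖ ^ 2 ≤ inner ℝ (u t) (y t)) {t : ℝ} (ht : 0 ≤ t) :
    ‖y t‖ ≤ ‖y 0‖ * Real.exp (-ρ * t) := by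
  -- This Lyapunov function is nonincreasing by `hu`.
  have hd : ∀ s ∈ Ici (0 : ℝ), HasDerivWithinAt (fun s => Real.exp (2 * ρ * s) * ‖y s‖ ^ 2)
      (2 * Real.exp (2 * ρ * s) * (ρ * ‖y s‖ ^ 2 - inner ℝ (u s) (y s))) (Ici 0) s := by
    intro s hs
    have h1 : HasDerivWithinAt (fun s => Real.exp (2 * ρ * s))
        (Real.exp (2 * ρ * s) * (2 * ρ * 1)) (Ici 0) s :=
      (((hasDerivAt_id s).const_mul (2 * ρ)).exp).hasDerivWithinAt
    refine (h1.mul (hy s hs).norm_sq).congr_deriv ?_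
    rw [inner_neg_right, real_inner_comm]
    ring
  have := image_le_of_deriv_right_le_deriv_boundary (a := 0) (b := t)
    (fun s hs => ((hd s hs.1).mono Icc_subset_Ici_self).continuousWithinAt)
    (fun s hs => (hd s hs.1).mono (Ici_subset_Ici.2 hs.1)) le_rfl continuousOn_const
    (fun s _ => hasDerivWithinAt_const _ _ _)
    (fun s hs => mul_nonpos_of_nonneg_of_nonpos (by positivity) (sub_nonpos.2 (hu s hs.1)))
    (right_mem_Icc.2 ht)
  simp only [mul_zero, Real.exp_zero, one_mul] at this
  refine (sq_le_sq₀ (norm_nonneg _) (by positivity)).1 ?_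
  have e : Real.exp (2 * ρ * t) = (Real.exp (-ρ * t) ^ 2)⁻¹ := by
    rw [← Real.exp_nat_mul, ← Real.exp_neg]; congr 1; push_cast; ring
  rw [e, inv_mul_le_iff₀ (by positivity)] at this
  rw [mul_pow]
  linarith

open Set in
/-- A first-order lag with pole `-ω` driven by `v` costs one power of `1 + t`. -/
theorem norm_le_of_first_order_lag {E : Type*} [NormedAddCommGroup E] [NormedSpace ℝ E]
    {w v : ℝ → E} {ω ρ A : ℝ} (hρ : ρ ≤ ω) {m : ℕ} (hA : 0 ≤ A)
    (hw : ∀ t ∈ Ici (0 : ℝ), HasDerivWithinAt w (v t - ω • w t) (Ici 0) t) (h0 : ‖w 0‖ ≤ A)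
    (hv : ∀ t ∈ Ici (0 : ℝ), ‖v t‖ ≤ A * (1 + t) ^ m * Real.exp (-ρ * t)) {t : ℝ} (ht : 0 ≤ t) :
    ‖w t‖ ≤ A * (1 + t) ^ (m + 1) * Real.exp (-ρ * t) := by
  have hexp : ∀ a s : ℝ, HasDerivAt (fun s => Real.exp (a * s)) (Real.exp (a * s) * a) s := by
    intro a s
    simpa using ((hasDerivAt_id s).const_mul a).exp
  have hd : ∀ s ∈ Ici (0 : ℝ), HasDerivWithinAt (fun s => Real.exp (ω * s) • w s)
      (Real.exp (ω * s) • v s) (Ici 0) s := by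
    intro s hs
    refine ((hexp ω s).hasDerivWithinAt.smul (hw s hs)).congr_deriv ?_
    rw [smul_sub, smul_smul]
    abel
  -- A majorant of exp(ωs) w(s): the first summand of its derivative already dominates exp(ωs) ‖v‖
  -- because m + 1 ≥ 1, and the second is nonnegative because ρ ≤ ω.
  have hB : ∀ s : ℝ, HasDerivAt (fun s => A * (1 + s) ^ (m + 1) * Real.exp ((ω - ρ) * s))
      (A * ((m + 1 : ℕ) * (1 + s) ^ m) * Real.exp ((ω - ρ) * s) +
        A * (1 + s) ^ (m + 1) * (Real.exp ((ω - ρ) * s) * (ω - ρ))) s := by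
    intro s
    have := ((((hasDerivAt_id s).const_add 1).pow (m + 1)).const_mul A).mul (hexp (ω - ρ) s)
    exact this.congr_deriv (by simp)
  have key := image_norm_le_of_norm_deriv_right_le_deriv_boundary (a := 0) (b := t)
    (fun s hs => ((hd s hs.1).mono Icc_subset_Ici_self).continuousWithinAt)
    (fun s hs => (hd s hs.1).mono (Ici_subset_Ici.2 hs.1)) (by simpa using h0) hB ?_
    (right_mem_Icc.2 ht)
  · rw [norm_smul, Real.norm_of_nonneg (Real.exp_pos _).le] at key
    have e : Real.exp ((ω - ρ) * t) = Real.exp (ω * t) * Real.exp (-ρ * t) := by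
      rw [← Real.exp_add]; congr 1; ring
    rw [e] at key
    refine le_of_mul_le_mul_left ?_ (Real.exp_pos (ω * t))
    linarith
  · intro s hs
    have hs0 : 0 ≤ s := hs.1
    rw [norm_smul, Real.norm_of_nonneg (Real.exp_pos _).le]
    have e : Real.exp ((ω - ρ) * s) = Real.exp (ω * s) * Real.exp (-ρ * s) := by
      rw [← Real.exp_add]; congr 1; ring
    have h1 : Real.exp (ω * s) * ‖v s‖ ≤ A * (1 + s) ^ m * Real.exp ((ω - ρ) * s) := by
      rw [e]
      have := mul_le_mul_of_nonneg_left (hv s hs.1) (Real.exp_pos (ω * s)).le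
      linarith
    have h2 : A * (1 + s) ^ m * Real.exp ((ω - ρ) * s) ≤
        A * ((m + 1 : ℕ) * (1 + s) ^ m) * Real.exp ((ω - ρ) * s) := by
      gcongr
      apply le_mul_of_one_le_left (by positivity)
      simp
    have h3 : 0 ≤ A * (1 + s) ^ (m + 1) * (Real.exp ((ω - ρ) * s) * (ω - ρ)) := by
      have := sub_nonneg.2 hρ
      positivity
    linarith

/-! ### Constant-coefficient operators and the cascade of lags. -/

open Polynomial in
/-- The differential operator with characteristic polynomial `P`, of degree at most `k`, applied
to the trajectory `x`. -/
noncomputable def diffOp {n : ℕ} (k : ℕ) (x : ℝ → EuclideanSpace ℝ (Fin n)) (P : ℝ[X]) (t : ℝ) :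
    EuclideanSpace ℝ (Fin n) :=
  ∑ l ∈ Finset.range (k + 1), P.coeff l • timeDeriv l x t

section diffOp

open Polynomial

variable {n k : ℕ} {x : ℝ → EuclideanSpace ℝ (Fin n)}

theorem diffOp_add (P Q : ℝ[X]) (t : ℝ) :
    diffOp k x (P + Q) t = diffOp k x P t + diffOp k x Q t := by
  simp [diffOp, add_smul, Finset.sum_add_distrib]

theorem diffOp_C_mul (a : ℝ) (P : ℝ[X]) (t : ℝ) :
    diffOp k x (C a * P) t = a • diffOp k x P t := by
  simp [diffOp, mul_smul, Finset.smul_sum]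

theorem diffOp_X_pow {j : ℕ} (hj : j ≤ k) (t : ℝ) :
    diffOp k x (X ^ j) t = timeDeriv j x t := by
  have : j < k + 1 := by omega
  simp [diffOp, coeff_X_pow, ite_smul, this]

theorem hasDerivWithinAt_timeDeriv (hx : ContDiffOn ℝ (k : WithTop ℕ∞) x (Set.Ici 0)) {j : ℕ}
    (hj : j < k) {t : ℝ} (ht : t ∈ Set.Ici (0 : ℝ)) :
    HasDerivWithinAt (timeDeriv j x) (timeDeriv (j + 1) x t) (Set.Ici 0) t := by
  have h := hx.differentiableOn_iteratedDerivWithin (m := j) (by exact_mod_cast hj)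
    (uniqueDiffOn_Ici 0) t ht
  have := h.hasDerivWithinAt
  rwa [← iteratedDerivWithin_succ] at this

theorem hasDerivWithinAt_diffOp (hx : ContDiffOn ℝ (k : WithTop ℕ∞) x (Set.Ici 0)) {P : ℝ[X]}
    (hP : P.natDegree < k) {t : ℝ} (ht : t ∈ Set.Ici (0 : ℝ)) :
    HasDerivWithinAt (diffOp k x P) (diffOp k x (X * P) t) (Set.Ici 0) t := by
  have e1 : diffOp k x P = fun t => ∑ l ∈ Finset.range k, P.coeff l • timeDeriv l x t := by
    ext1 t
    rw [diffOp, Finset.sum_range_succ, coeff_eq_zero_of_natDegree_lt hP, zero_smul, add_zero]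
  have e2 : diffOp k x (X * P) t =
      ∑ l ∈ Finset.range k, P.coeff l • timeDeriv (l + 1) x t := by
    rw [diffOp, Finset.sum_range_succ']
    simp
  rw [e1, e2]
  exact HasDerivWithinAt.fun_sum fun l hl =>
    (hasDerivWithinAt_timeDeriv hx (Finset.mem_range.1 hl) ht).const_smul (P.coeff l)

theorem norm_diffOp_le {P : ℝ[X]} (hP : P.natDegree < k) (t : ℝ) :
    ‖diffOp k x P t‖ ≤ (∑ l ∈ Finset.range k, |P.coeff l|) * ‖state k x t‖ := by
  rw [diffOp, Finset.sum_range_succ, coeff_eq_zero_of_natDegree_lt hP, zero_smul, add_zero,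
    Finset.sum_mul]
  refine norm_sum_le_of_le _ fun l hl => ?_
  rw [norm_smul, Real.norm_eq_abs]
  gcongr
  exact norm_le_pi_norm (state k x t) ⟨l, Finset.mem_range.1 hl⟩

/-- D = (D + ω) - ω: a derivative is traded for the next lag. -/
theorem diffOp_X_mul_X_add_C_pow (ω : ℝ) (i : ℕ) (P : ℝ[X]) (t : ℝ) :
    diffOp k x (X * (P * (X + C ω) ^ i)) t =
      diffOp k x (P * (X + C ω) ^ (i + 1)) t - ω • diffOp k x (P * (X + C ω) ^ i) t := by
  rw [eq_sub_iff_add_eq, ← diffOp_C_mul, ← diffOp_add]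
  congr 1
  ring

/-- If the lags `(D + ω)^i x` are bounded by `B` for all `i < k`, so is the state, up to a
constant. -/
theorem norm_state_le_of_lags {ω B : ℝ} (hω : 0 ≤ ω) (hB : 0 ≤ B) {t : ℝ}
    (h : ∀ i < k, ‖diffOp k x ((X + C ω) ^ i) t‖ ≤ B) :
    ‖state k x t‖ ≤ (1 + ω) ^ k * B := by
  -- Each of the j factors D is replaced by (D + ω) - ω, at the price of a factor 1 + ω; i + j < k
  -- keeps every lag that occurs below order k.
  have key : ∀ j i : ℕ, i + j < k → ‖diffOp k x (X ^ j * (X + C ω) ^ i) t‖ ≤ (1 + ω) ^ j * B := by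
    intro j
    induction j with
    | zero => intro i hi; simpa using h i hi
    | succ j ih =>
      intro i hi
      rw [pow_succ', mul_assoc, diffOp_X_mul_X_add_C_pow]
      have h1 := ih (i + 1) (by omega)
      have h2 := ih i (by omega)
      have h3 := norm_sub_le (diffOp k x (X ^ j * (X + C ω) ^ (i + 1)) t)
        (ω • diffOp k x (X ^ j * (X + C ω) ^ i) t)
      rw [norm_smul, Real.norm_of_nonneg hω] at h3
      have h4 := mul_le_mul_of_nonneg_left h2 hω
      calc _ ≤ _ := h3
        _ ≤ (1 + ω) ^ j * B + ω * ((1 + ω) ^ j * B) := add_le_add h1 h4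
        _ = _ := by ring
  refine (pi_norm_le_iff_of_nonneg (by positivity)).2 fun j => ?_
  have := key j 0 (by simp)
  rw [pow_zero, mul_one, diffOp_X_pow j.2.le] at this
  refine this.trans ?_
  gcongr
  · linarith
  · exact j.2.le

/-- Decay of the cascade `(D + ω)^i x`, `i < k`, driven by its last member. -/
theorem norm_lag_le (hx : ContDiffOn ℝ (k : WithTop ℕ∞) x (Set.Ici 0)) {ω ρ A : ℝ} (hρ : ρ ≤ ω)
    (hA : 0 ≤ A) (h0 : ∀ i < k, ‖diffOp k x ((X + C ω) ^ i) 0‖ ≤ A)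
    (hlast : ∀ t ∈ Set.Ici (0 : ℝ),
      ‖diffOp k x ((X + C ω) ^ (k - 1)) t‖ ≤ A * Real.exp (-ρ * t)) (m : ℕ) (hm : m < k) :
    ∀ t ∈ Set.Ici (0 : ℝ),
      ‖diffOp k x ((X + C ω) ^ (k - 1 - m)) t‖ ≤ A * (1 + t) ^ m * Real.exp (-ρ * t) := by
  induction m with
  | zero => simpa using hlast
  | succ m ih =>
    intro t ht
    refine norm_le_of_first_order_lag hρ hA (fun s hs => ?_) (h0 _ (by omega)) (ih (by omega)) ht
    have hdeg : ((X + C ω) ^ (k - 1 - (m + 1))).natDegree < k := by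
      rw [natDegree_pow, natDegree_X_add_C]; omega
    have := hasDerivWithinAt_diffOp hx hdeg hs
    have e := diffOp_X_mul_X_add_C_pow (k := k) (x := x) ω (k - 1 - (m + 1)) 1 s
    simp only [one_mul] at e
    rw [show k - 1 - (m + 1) + 1 = k - 1 - m by omega] at e
    rwa [e] at this

/-- Passes decay of the last lag down the cascade and then to the state. The constant depends only
on k and ω: M below bounds all initial lags in terms of the initial state. -/
theorem norm_state_le_of_last_lag {ω ρ : ℝ} (hω : 0 ≤ ω) (hρ : ρ ≤ ω) (hk : 0 < k) :
    ∃ c : ℝ, 1 ≤ c ∧ ∀ x : ℝ → EuclideanSpace ℝ (Fin n),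
      ContDiffOn ℝ (k : WithTop ℕ∞) x (Set.Ici 0) →
      (∀ t ∈ Set.Ici (0 : ℝ), ‖diffOp k x ((X + C ω) ^ (k - 1)) t‖ ≤
        ‖diffOp k x ((X + C ω) ^ (k - 1)) 0‖ * Real.exp (-ρ * t)) →
      ∀ t : ℝ, 0 ≤ t → ‖state k x t‖ ≤
        c * ‖state k x 0‖ * (1 + t) ^ (k - 1) * Real.exp (-ρ * t) := by
  set M : ℝ := ∑ i ∈ Finset.range k, ∑ l ∈ Finset.range k, |((X + C ω) ^ i : ℝ[X]).coeff l| with hM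
  have hM0 : 0 ≤ M := Finset.sum_nonneg fun i _ => Finset.sum_nonneg fun l _ => abs_nonneg _
  refine ⟨max 1 ((1 + ω) ^ k * M), le_max_left _ _, fun x hx hlast t ht => ?_⟩
  have h0 : ∀ i < k, ‖diffOp k x ((X + C ω) ^ i) 0‖ ≤ M * ‖state k x 0‖ := by
    intro i hi
    refine (norm_diffOp_le ?_ 0).trans ?_
    · rw [natDegree_pow, natDegree_X_add_C]; omega
    · gcongr
      exact Finset.single_le_sum
        (f := fun i => ∑ l ∈ Finset.range k, |((X + C ω) ^ i : ℝ[X]).coeff l|)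
        (fun i _ => Finset.sum_nonneg fun l _ => abs_nonneg _) (Finset.mem_range.2 hi)
  have hB : ∀ i < k, ‖diffOp k x ((X + C ω) ^ i) t‖ ≤
      M * ‖state k x 0‖ * (1 + t) ^ (k - 1) * Real.exp (-ρ * t) := by
    intro i hi
    have := norm_lag_le hx hρ (by positivity) h0
      (fun t ht => (hlast t ht).trans (by gcongr; exact h0 _ (by omega))) (k - 1 - i) (by omega) t ht
    rw [show k - 1 - (k - 1 - i) = i by omega] at this
    refine this.trans ?_
    have hpow : (1 + t) ^ (k - 1 - i) ≤ (1 + t) ^ (k - 1) :=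
      pow_le_pow_right₀ (by linarith) (Nat.sub_le _ _)
    gcongr M * ‖state k x 0‖ * ?_ * Real.exp (-ρ * t)
  refine (norm_state_le_of_lags hω (by positivity) hB).trans ?_
  have : (1 + ω) ^ k * (M * ‖state k x 0‖ * (1 + t) ^ (k - 1) * Real.exp (-ρ * t)) =
      ((1 + ω) ^ k * M) * ‖state k x 0‖ * (1 + t) ^ (k - 1) * Real.exp (-ρ * t) := by ring
  rw [this]
  gcongr
  exact le_max_right _ _

end diffOp

end GradAlg

/-! ### The coefficients as binomial expansions, and the hidden gradient flow. -/

namespace GradAlg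

section coefficients

open Polynomial

variable {n k : ℕ}

theorem pow_mul_root_eq {κ q : ℝ} (hqk : κ ^ ((1 : ℝ) / k) = q) (hκ : 0 < κ) (hk : 0 < k) :
    q ^ (k - 1) * q = κ := by
  rw [← pow_succ, Nat.sub_add_cancel hk, ← hqk, ← Real.rpow_natCast, ← Real.rpow_mul hκ.le,
    one_div_mul_cancel, Real.rpow_one]
  exact_mod_cast hk.ne'

theorem hCoeff_zero (κ : ℝ) (k : ℕ) : hCoeff κ k 0 = 1 := by simp [hCoeff]

theorem hCoeff_eq_coeff {κ q : ℝ} (hq : 0 < q) (hqk : κ ^ ((1 : ℝ) / k) = q) (hκ : 0 < κ)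
    {j : ℕ} (hj : j ≤ k - 1) :
    hCoeff κ k j = q ^ (k - 1) * ((X + C (1 / q)) ^ (k - 1) : ℝ[X]).coeff j := by
  have h1 : κ ^ ((j : ℝ) / k) = q ^ j := by
    rw [← hqk, ← Real.rpow_natCast, ← Real.rpow_mul hκ.le]; congr 1; ring
  rw [hCoeff, h1, coeff_X_add_C_pow, ← mul_assoc, one_div, inv_pow, ← div_eq_mul_inv,
    div_eq_of_eq_mul (pow_ne_zero _ hq.ne')]
  rw [← pow_add, Nat.add_sub_cancel' hj]

/-- Explains the correction -h_j/κ in g_j: adding y/κ to both sides of the equation completes the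
left side to (D + 1/q)^k x. -/
theorem gCoeff_add_eq_coeff {κ q : ℝ} (hqk : κ ^ ((1 : ℝ) / k) = q) (hκ : 0 < κ)
    {j : ℕ} (hj : j ≤ k) :
    gCoeff κ k j + hCoeff κ k j / κ = ((X + C (1 / q)) ^ k : ℝ[X]).coeff j := by
  have h1 : κ ^ (((k : ℝ) - j) / k) = q ^ (k - j) := by
    rw [← hqk, ← Real.rpow_natCast, ← Real.rpow_mul hκ.le, Nat.cast_sub hj]; congr 1; ring
  rw [gCoeff, sub_add_cancel, h1, coeff_X_add_C_pow, div_pow, one_pow]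

theorem sum_Icc_one_eq_sum_range {M : Type*} [AddCommMonoid M] (u : ℕ → M) (m : ℕ) :
    ∑ j ∈ Finset.Icc 1 m, u j = ∑ j ∈ Finset.range m, u (j + 1) := by
  induction m with
  | zero => simp
  | succ m ih => rw [Finset.sum_Icc_succ_top (by omega), ih, Finset.sum_range_succ]

/-- The argument of the gradient in the system is `κ^((k-1)/k) (D + κ^(-1/k))^(k-1) x`. -/
theorem output_eq_diffOp {κ q : ℝ} (hq : 0 < q) (hqk : κ ^ ((1 : ℝ) / k) = q) (hκ : 0 < κ)
    (hk : 0 < k) (x : ℝ → EuclideanSpace ℝ (Fin n)) (t : ℝ) :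
    x t + ∑ j ∈ Finset.Icc 1 (k - 1), hCoeff κ k j • timeDeriv j x t =
      q ^ (k - 1) • diffOp k x ((X + C (1 / q)) ^ (k - 1)) t := by
  have hdeg : ((X + C (1 / q)) ^ (k - 1) : ℝ[X]).natDegree < k := by
    rw [natDegree_pow, natDegree_X_add_C]; omega
  rw [diffOp, Finset.sum_range_succ, coeff_eq_zero_of_natDegree_lt hdeg, zero_smul, add_zero,
    Finset.smul_sum, sum_Icc_one_eq_sum_range]
  have : ∀ l ∈ Finset.range k, q ^ (k - 1) • (((X + C (1 / q)) ^ (k - 1) : ℝ[X]).coeff l •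
      timeDeriv l x t) = hCoeff κ k l • timeDeriv l x t := by
    intro l hl
    rw [smul_smul, ← hCoeff_eq_coeff hq hqk hκ (by have := Finset.mem_range.1 hl; omega)]
  rw [Finset.sum_congr rfl this]
  obtain ⟨m, rfl⟩ := Nat.exists_eq_add_of_lt hk
  simp only [zero_add, Nat.add_sub_cancel]
  rw [Finset.sum_range_succ', hCoeff_zero, one_smul, add_comm]
  simp [timeDeriv]

/-- In terms of the output `y = x + ∑ h_j x⁽ʲ⁾` the system reads
`(D + κ^(-1/k))^k x = y / κ - ∇f(y) / L`. -/
theorem IsSolution.diffOp_pow_eq {κ q L : ℝ} (hq : 0 < q) (hqk : κ ^ ((1 : ℝ) / k) = q)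
    (hκ : 0 < κ) (hk : 0 < k) {f : EuclideanSpace ℝ (Fin n) → ℝ}
    {x : ℝ → EuclideanSpace ℝ (Fin n)} (hx : IsSolution κ L k f x) {t : ℝ} (ht : 0 ≤ t) :
    diffOp k x ((X + C (1 / q)) ^ k) t =
      (1 / κ) • (q ^ (k - 1) • diffOp k x ((X + C (1 / q)) ^ (k - 1)) t) -
        (1 / L) • gradient f (q ^ (k - 1) • diffOp k x ((X + C (1 / q)) ^ (k - 1)) t) := by
  have hq0 : q ^ k = κ := by
    rw [← pow_mul_root_eq hqk hκ hk, ← pow_succ, Nat.sub_add_cancel hk]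
  have h := hx.2 t ht
  rw [output_eq_diffOp hq hqk hκ hk] at h
  rw [diffOp, Finset.sum_range_succ, coeff_X_add_C_pow, Nat.sub_self, pow_zero, Nat.choose_self,
    Nat.cast_one, one_mul, one_smul, h]
  have e : ∑ l ∈ Finset.range k, ((X + C (1 / q)) ^ k : ℝ[X]).coeff l • timeDeriv l x t =
      ∑ j ∈ Finset.Icc 1 (k - 1), gCoeff κ k j • timeDeriv j x t +
      (1 / κ) • (q ^ (k - 1) • diffOp k x ((X + C (1 / q)) ^ (k - 1)) t) := by
    rw [← output_eq_diffOp hq hqk hκ hk, smul_add, Finset.smul_sum, add_left_comm,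
      ← Finset.sum_add_distrib]
    have : ∀ j ∈ Finset.Icc 1 (k - 1), gCoeff κ k j • timeDeriv j x t +
        (1 / κ) • (hCoeff κ k j • timeDeriv j x t) =
        ((X + C (1 / q)) ^ k : ℝ[X]).coeff j • timeDeriv j x t := by
      intro j hj
      rw [← gCoeff_add_eq_coeff hqk hκ (by have := (Finset.mem_Icc.1 hj).2; omega), smul_smul,
        ← add_smul]
      congr 1
      ring
    rw [Finset.sum_congr rfl this, sum_Icc_one_eq_sum_range]
    -- The system has no g_0; the missing constant term is the x/κ contained in y/κ.
    have hc : ((X + C (1 / q)) ^ k : ℝ[X]).coeff 0 = 1 / κ := by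
      rw [coeff_X_add_C_pow, Nat.sub_zero, Nat.choose_zero_right, Nat.cast_one, mul_one, div_pow,
        one_pow, hq0]
    rw [← hc]
    obtain ⟨m, rfl⟩ := Nat.exists_eq_add_of_lt hk
    simp only [zero_add, Nat.add_sub_cancel]
    rw [Finset.sum_range_succ', add_comm]
    simp [timeDeriv]
  rw [e]
  abel

/-- The output of the system follows a gradient flow, so that strong monotonicity of the gradient
with respect to the origin makes all trajectories decay. -/
theorem norm_state_le_of_inner_ge {κ q L ρ : ℝ} (hq : 0 < q) (hqk : κ ^ ((1 : ℝ) / k) = q)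
    (hκ : 0 < κ) (hk : 0 < k) {f : EuclideanSpace ℝ (Fin n) → ℝ} (hρ : ρ ≤ 1 / q)
    (hf : ∀ y, ρ * ‖y‖ ^ 2 ≤ q ^ (k - 1) * inner ℝ ((1 / L) • gradient f y) y) :
    ∃ c : ℝ, 1 ≤ c ∧ ∀ x, IsSolution κ L k f x → ∀ t : ℝ, 0 ≤ t → ‖state k x t‖ ≤
      c * ‖state k x 0‖ * (1 + t) ^ (k - 1) * Real.exp (-ρ * t) := by
  obtain ⟨c, hc, h⟩ := norm_state_le_of_last_lag (n := n) (one_div_nonneg.2 hq.le) hρ hk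
  refine ⟨c, hc, fun x hx => h x hx.1 fun t ht => ?_⟩
  set Y := diffOp k x ((X + C (1 / q)) ^ (k - 1)) with hY
  have hdeg : ((X + C (1 / q)) ^ (k - 1) : ℝ[X]).natDegree < k := by
    rw [natDegree_pow, natDegree_X_add_C]; omega
  have hqκ := pow_mul_root_eq hqk hκ hk
  refine norm_le_exp_of_inner_ge (u := fun t => (1 / L) • gradient f (q ^ (k - 1) • Y t))
    (fun s hs => ?_) (fun s _ => ?_) ht
  -- DY = (D + 1/q)^k x - Y/q, and y/κ = Y/q cancels, leaving the gradient alone.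
  · refine (hasDerivWithinAt_diffOp hx.1 hdeg hs).congr_deriv ?_
    have e := diffOp_X_mul_X_add_C_pow (k := k) (x := x) (1 / q) (k - 1) 1 s
    simp only [one_mul] at e
    rw [e, Nat.sub_add_cancel hk, hx.diffOp_pow_eq hq hqk hκ hk hs, ← hY, smul_smul,
      show 1 / κ * q ^ (k - 1) = 1 / q by rw [← hqκ]; field_simp]
    abel
  · have hp : 0 < q ^ (k - 1) := by positivity
    have := hf (q ^ (k - 1) • Y s)
    rw [norm_smul, Real.norm_of_nonneg hp.le, inner_smul_right, mul_pow] at this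
    have h2 : q ^ (k - 1) * q ^ (k - 1) * (ρ * ‖Y s‖ ^ 2) ≤ q ^ (k - 1) * q ^ (k - 1) *
        inner ℝ ((1 / L) • gradient f (q ^ (k - 1) • Y s)) (Y s) := by linarith
    exact le_of_mul_le_mul_left h2 (by positivity)

end coefficients

/-! ### Monotonicity from the sector condition. -/

section sector

variable {n : ℕ} {L α : ℝ} {f : EuclideanSpace ℝ (Fin n) → ℝ}

/-- Expand the product and drop ‖u‖². The constant is not sharp, but no upper bound on α is needed
and positivity suffices for stability. -/
theorem SectorCondition.le_inner (hα : 0 < α) (h : SectorCondition L α f)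
    (y : EuclideanSpace ℝ (Fin n)) :
    α / (1 + α) * ‖y‖ ^ 2 ≤ inner ℝ ((1 / L) • gradient f y) y := by
  have h1 := h y
  generalize (1 / L) • gradient f y = u at h1 ⊢
  rw [inner_sub_left, inner_sub_right, inner_sub_right, inner_smul_left, inner_smul_left,
    conj_trivial, real_inner_self_eq_norm_sq, real_inner_self_eq_norm_sq, real_inner_comm u y] at h1
  rw [div_mul_eq_mul_div, div_le_iff₀ (by positivity)]
  nlinarith [sq_nonneg ‖u‖]

/-- The sharp constant, needed for the exact rate: the sector condition says ‖u - αy‖² ≤ (1 - α)⟨u -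
αy, y⟩, so the inner product is nonnegative if α < 1, while α = 1 forces u = y. -/
theorem SectorCondition.le_inner_of_le_one (hα : α ≤ 1) (h : SectorCondition L α f)
    (y : EuclideanSpace ℝ (Fin n)) :
    α * ‖y‖ ^ 2 ≤ inner ℝ ((1 / L) • gradient f y) y := by
  have h1 := h y
  generalize (1 / L) • gradient f y = u at h1 ⊢
  have e : u - y = (u - α • y) - (1 - α) • y := by rw [sub_smul, one_smul]; abel
  rcases hα.eq_or_lt with rfl | hα
  · rw [one_smul, real_inner_self_nonpos, sub_eq_zero] at h1
    rw [h1, real_inner_self_eq_norm_sq, one_mul]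
  · rw [e, inner_sub_right, inner_smul_right, real_inner_self_eq_norm_sq, inner_sub_left,
      inner_smul_left, conj_trivial, real_inner_self_eq_norm_sq] at h1
    have h2 : 0 ≤ (1 - α) * (inner ℝ u y - α * ‖y‖ ^ 2) := by
      linarith [sq_nonneg ‖u - α • y‖]
    have := nonneg_of_mul_nonneg_right h2 (sub_pos.2 hα)
    linarith

end sector

/-! ### Solutions through every initial state. -/

section existence

variable {n k : ℕ}

/-- The `l`-th component of a state, as a linear map; `0` if there is none. -/
noncomputable def component (n k l : ℕ) :
    (Fin k → EuclideanSpace ℝ (Fin n)) →L[ℝ] EuclideanSpace ℝ (Fin n) :=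
  if h : l < k then ContinuousLinearMap.proj ⟨l, h⟩ else 0

theorem component_of_lt {l : ℕ} (h : l < k) (z : Fin k → EuclideanSpace ℝ (Fin n)) :
    component n k l z = z ⟨l, h⟩ := by
  simp [component, h]

/-- The highest derivative prescribed by the system. -/
noncomputable def topDeriv (κ L : ℝ) (k : ℕ) (f : EuclideanSpace ℝ (Fin n) → ℝ)
    (z : Fin k → EuclideanSpace ℝ (Fin n)) : EuclideanSpace ℝ (Fin n) :=
  - (∑ j ∈ Finset.Icc 1 (k - 1), gCoeff κ k j • component n k j z)
    - (1 / L) • gradient f (component n k 0 z +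
        ∑ j ∈ Finset.Icc 1 (k - 1), hCoeff κ k j • component n k j z)

/-- The vector field of the first-order system for the state. -/
noncomputable def vectorField (κ L : ℝ) (k : ℕ) (f : EuclideanSpace ℝ (Fin n) → ℝ)
    (z : Fin k → EuclideanSpace ℝ (Fin n)) : Fin k → EuclideanSpace ℝ (Fin n) :=
  fun j => if (j : ℕ) + 1 < k then component n k (j + 1) z else topDeriv κ L k f z

theorem exists_lipschitzWith_topDeriv (κ L : ℝ) (k : ℕ) {f : EuclideanSpace ℝ (Fin n) → ℝ}
    (hf : ∃ K, LipschitzWith K (gradient f)) : ∃ K, LipschitzWith K (topDeriv κ L k f) := by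
  obtain ⟨K, hK⟩ := hf
  let G := ∑ j ∈ Finset.Icc 1 (k - 1), gCoeff κ k j • component n k j
  let H := component n k 0 + ∑ j ∈ Finset.Icc 1 (k - 1), hCoeff κ k j • component n k j
  have e : topDeriv κ L k f = fun z => -(G z) - (1 / L) • gradient f (H z) := by
    ext1 z
    simp [topDeriv, G, H, sum_apply]
  rw [e]
  exact ⟨_, G.lipschitz.neg.sub ((lipschitzWith_smul (1 / L)).comp (hK.comp H.lipschitz))⟩

theorem exists_lipschitzWith_vectorField (κ L : ℝ) (k : ℕ) {f : EuclideanSpace ℝ (Fin n) → ℝ}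
    (hf : ∃ K, LipschitzWith K (gradient f)) : ∃ K, LipschitzWith K (vectorField κ L k f) := by
  have h : ∀ j : Fin k, ∃ K, LipschitzWith K (fun z => vectorField κ L k f z j) := by
    intro j
    unfold vectorField
    split_ifs with hj
    · exact ⟨_, (component n k (j + 1)).lipschitz⟩
    · exact exists_lipschitzWith_topDeriv κ L k hf
  choose K hK using h
  refine ⟨Finset.univ.sup K, LipschitzWith.of_dist_le_mul fun z w => ?_⟩
  refine (dist_pi_le_iff (by positivity)).2 fun j => ?_
  refine ((hK j).dist_le_mul z w).trans ?_
  gcongr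
  exact Finset.le_sup (Finset.mem_univ j)

/-- The first component of an integral curve of `vectorField` is the solution; the other components
are its derivatives by induction. It is C^k because its k-th derivative is `topDeriv` along a
continuous curve. -/
theorem exists_isSolution (κ L : ℝ) (hk : 0 < k) {f : EuclideanSpace ℝ (Fin n) → ℝ}
    (hf : ∃ K, LipschitzWith K (gradient f)) (z₀ : Fin k → EuclideanSpace ℝ (Fin n)) :
    ∃ x, IsSolution κ L k f x ∧ state k x 0 = z₀ := by
  obtain ⟨K, hK⟩ := exists_lipschitzWith_vectorField κ L k hf
  obtain ⟨K', hK'⟩ := exists_lipschitzWith_topDeriv κ L k hf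
  obtain ⟨γ, h0, hγ⟩ := exists_integralCurve_Ici_of_lipschitz hK z₀
  have hcomp : ∀ j, ∀ t ∈ Set.Ici (0 : ℝ), HasDerivWithinAt (fun t => component n k j (γ t))
      (component n k j (vectorField κ L k f (γ t))) (Set.Ici 0) t := fun j t ht =>
    (component n k j).hasFDerivAt.comp_hasDerivWithinAt t (hγ t ht)
  set x : ℝ → EuclideanSpace ℝ (Fin n) := fun t => component n k 0 (γ t) with hx
  have hd : ∀ j < k, ∀ t ∈ Set.Ici (0 : ℝ), timeDeriv j x t = component n k j (γ t) := by
    intro j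
    induction j with
    | zero => intro _ t _; simp [timeDeriv, hx]
    | succ j ih =>
      intro hj t ht
      have ih := ih (by omega)
      have h1 := (hcomp j t ht).congr (f₁ := timeDeriv j x) ih (ih t ht)
      rw [timeDeriv, iteratedDerivWithin_succ]
      refine (h1.derivWithin (uniqueDiffOn_Ici 0 t ht)).trans ?_
      rw [component_of_lt (by omega)]
      simp [vectorField, hj]
  have htop : ∀ t ∈ Set.Ici (0 : ℝ), timeDeriv k x t = topDeriv κ L k f (γ t) := by
    intro t ht
    have ih := hd (k - 1) (by omega)
    have h1 := (hcomp (k - 1) t ht).congr (f₁ := timeDeriv (k - 1) x) ih (ih t ht)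
    have h2 : timeDeriv k x t = derivWithin (timeDeriv (k - 1) x) (Set.Ici 0) t := by
      conv_lhs => rw [show k = k - 1 + 1 by omega, timeDeriv, iteratedDerivWithin_succ]
      rfl
    rw [h2, h1.derivWithin (uniqueDiffOn_Ici 0 t ht), component_of_lt (by omega)]
    simp only [vectorField]
    rw [if_neg (by omega)]
  have hγc : ContinuousOn γ (Set.Ici 0) := fun t ht => (hγ t ht).continuousWithinAt
  refine ⟨x, ⟨?_, fun t ht => ?_⟩, ?_⟩
  · rw [contDiffOn_nat_iff_continuousOn_differentiableOn_deriv (uniqueDiffOn_Ici 0)]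
    refine ⟨fun m hm => ?_, fun m hm t ht => ?_⟩
    · rcases hm.eq_or_lt with rfl | hm
      · exact (hK'.continuous.comp_continuousOn hγc).congr htop
      · exact ((component n k m).continuous.comp_continuousOn hγc).congr (hd m hm)
    · exact ((hcomp m t ht).congr (hd m hm) (hd m hm t ht)).differentiableWithinAt
  · rw [htop t ht, topDeriv]
    have hj : ∀ a : ℕ → ℝ, ∑ j ∈ Finset.Icc 1 (k - 1), a j • component n k j (γ t) =
        ∑ j ∈ Finset.Icc 1 (k - 1), a j • timeDeriv j x t := by
      refine fun a => Finset.sum_congr rfl fun j hj => ?_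
      rw [hd j (by have := Finset.mem_Icc.1 hj; omega) t ht]
    rw [hj, hj]
  · ext1 j
    rw [state, hd j j.2 0 Set.self_mem_Ici, component_of_lt j.2, h0]

end existence

/-! ### From polynomial-times-exponential bounds to rates and stability. -/

section conclusion

variable {n k : ℕ}

/-- `(1 + t)^m` is dominated by every growing exponential. -/
theorem exists_pow_le_exp (m : ℕ) {δ : ℝ} (hδ : 0 < δ) :
    ∃ c : ℝ, 1 ≤ c ∧ ∀ t : ℝ, 0 ≤ t → (1 + t) ^ m ≤ c * Real.exp (δ * t) := by
  refine ⟨max 1 (m.factorial / δ ^ m * Real.exp δ), le_max_left _ _, fun t ht => ?_⟩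
  -- One term of the series of exp(δ(1 + t)); the factor exp δ goes into the constant.
  have h := Real.pow_div_factorial_le_exp (x := δ * (1 + t)) (by positivity) m
  rw [div_le_iff₀ (by positivity), mul_pow, mul_add, mul_one, Real.exp_add] at h
  have h2 : (1 + t) ^ m ≤ m.factorial / δ ^ m * Real.exp δ * Real.exp (δ * t) := by
    rw [div_mul_eq_mul_div, div_mul_eq_mul_div, le_div_iff₀ (by positivity)]
    linarith
  refine h2.trans ?_
  gcongr
  exact le_max_right _ _

theorem convergesWithRate_of_pow_mul_exp_bound {κ L ρ : ℝ} {f : EuclideanSpace ℝ (Fin n) → ℝ}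
    (h : ∃ c : ℝ, 1 ≤ c ∧ ∀ x, IsSolution κ L k f x → ∀ t : ℝ, 0 ≤ t → ‖state k x t‖ ≤
      c * ‖state k x 0‖ * (1 + t) ^ (k - 1) * Real.exp (-ρ * t)) :
    ConvergesWithRate κ L k f ρ := by
  intro r hr
  obtain ⟨c, hc, h⟩ := h
  obtain ⟨d, hd, h'⟩ := exists_pow_le_exp (k - 1) (sub_pos.2 hr)
  refine ⟨c * d, one_le_mul_of_one_le_of_one_le hc hd, fun x hx t ht => (h x hx t ht).trans ?_⟩
  have e : Real.exp (-r * t) = Real.exp ((ρ - r) * t) * Real.exp (-ρ * t) := by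
    rw [← Real.exp_add]; congr 1; ring
  calc _ ≤ c * ‖state k x 0‖ * (d * Real.exp ((ρ - r) * t)) * Real.exp (-ρ * t) := by
        gcongr; exact h' t ht
    _ = _ := by rw [e]; ring

theorem isSolution_zero {κ L : ℝ} {f : EuclideanSpace ℝ (Fin n) → ℝ} (h0 : gradient f 0 = 0) :
    IsSolution κ L k f (fun _ => 0) := by
  refine ⟨contDiffOn_const, fun t _ => ?_⟩
  have : ∀ j, timeDeriv j (fun _ : ℝ => (0 : EuclideanSpace ℝ (Fin n))) t = 0 := by
    intro j
    simp [timeDeriv]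
  simp [this, h0]

theorem originGloballyAsymptoticallyStable_of_convergesWithRate {κ L ρ : ℝ} (hk : 0 < k)
    (hρ : 0 < ρ) {f : EuclideanSpace ℝ (Fin n) → ℝ} (hf : ∃ K, LipschitzWith K (gradient f))
    (h0 : gradient f 0 = 0) (h : ConvergesWithRate κ L k f ρ) :
    OriginGloballyAsymptoticallyStable κ L k f := by
  obtain ⟨c, hc, h⟩ := h (ρ / 2) (by linarith)
  refine ⟨exists_isSolution κ L hk hf, isSolution_zero h0, fun ε hε => ?_, fun x hx => ?_⟩
  · refine ⟨ε / c, by positivity, fun x hx hx0 t ht => ?_⟩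
    have h1 : Real.exp (-(ρ / 2) * t) ≤ 1 := Real.exp_le_one_iff.2 (by nlinarith)
    calc ‖state k x t‖ ≤ c * ‖state k x 0‖ * Real.exp (-(ρ / 2) * t) := h x hx t ht
      _ ≤ c * ‖state k x 0‖ * 1 := by gcongr
      _ < ε := by rwa [mul_one, mul_comm, ← lt_div_iff₀ (by positivity)]
  · rw [tendsto_zero_iff_norm_tendsto_zero]
    have hlim : Filter.Tendsto (fun t => c * ‖state k x 0‖ * Real.exp (-(ρ / 2) * t)) Filter.atTop
        (nhds (c * ‖state k x 0‖ * 0)) := by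
      refine (Real.tendsto_exp_atBot.comp ?_).const_mul _
      exact Filter.tendsto_id.const_mul_atTop_of_neg (by linarith)
    rw [mul_zero] at hlim
    refine squeeze_zero' (.of_forall fun _ => norm_nonneg _) ?_ hlim
    filter_upwards [Filter.eventually_ge_atTop 0] with t ht using h x hx t ht

end conclusion

end GradAlg

theorem mainTheorem3 (n k : ℕ) (hn : 0 < n) (hk : 0 < k) (μ L κ : ℝ) (hμ : 0 < μ) (hμL : μ ≤ L)
    (hκ : κ = L / μ) (C : Set (EuclideanSpace ℝ (Fin n) → ℝ))
    (hC : GradAlg.IsFunctionClass μ L C) (f : EuclideanSpace ℝ (Fin n) → ℝ) (hf : f ∈ C) :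
    (∀ α : ℝ, 0 < α → GradAlg.SectorCondition L α f →
      GradAlg.OriginGloballyAsymptoticallyStable κ L k f) ∧
    (GradAlg.SectorCondition L (1 / κ) f →
      GradAlg.ConvergesWithRate κ L k f (1 / κ ^ ((1 : ℝ) / (k : ℝ))) ∧
      ∃ c : ℝ, 1 ≤ c ∧ ∀ x, GradAlg.IsSolution κ L k f x → ∀ t : ℝ, 0 ≤ t →
        ‖GradAlg.state k x t‖ ≤ c * ‖GradAlg.state k x 0‖ * (1 + t) ^ (k - 1) *
          Real.exp (-(1 / κ ^ ((1 : ℝ) / (k : ℝ))) * t)) ∧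
    (StrongConvexOn Set.univ μ f → LipschitzWith L.toNNReal (gradient f) →
      GradAlg.SectorCondition L (1 / κ) f) := by
  have hκ1 : 1 ≤ κ := by rw [hκ, one_le_div hμ]; exact hμL
  have hκ0 : 0 < κ := by linarith
  have h0 : gradient f 0 = 0 := by
    rw [gradient, (hC.isLocalMin_zero f hf).fderiv_eq_zero, map_zero]
  obtain ⟨q, hqk⟩ : ∃ q, κ ^ ((1 : ℝ) / k) = q := ⟨_, rfl⟩
  have hq : 0 < q := hqk ▸ Real.rpow_pos_of_pos hκ0 _
  have hqκ := GradAlg.pow_mul_root_eq hqk hκ0 hk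
  refine ⟨fun α hα hs => ?_, fun hs => ?_, fun hc hL => ?_⟩
  -- The slower of two rates: the pole of the lags and the decay of the gradient flow.
  · set ρ := min (1 / q) (q ^ (k - 1) * (α / (1 + α))) with hρ
    refine GradAlg.originGloballyAsymptoticallyStable_of_convergesWithRate (ρ := ρ) hk
      (by positivity) (hC.lipschitz_gradient f hf) h0 (GradAlg.convergesWithRate_of_pow_mul_exp_bound
        (GradAlg.norm_state_le_of_inner_ge hq hqk hκ0 hk (min_le_left _ _) fun y => ?_))
    calc ρ * ‖y‖ ^ 2 ≤ q ^ (k - 1) * (α / (1 + α)) * ‖y‖ ^ 2 := by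
          gcongr; exact min_le_right _ _
      _ = q ^ (k - 1) * (α / (1 + α) * ‖y‖ ^ 2) := mul_assoc _ _ _
      _ ≤ _ := by gcongr; exact hs.le_inner hα y
  · rw [hqk]
    have key := GradAlg.norm_state_le_of_inner_ge (L := L) (f := f) hq hqk hκ0 hk le_rfl fun y => ?_
    · exact ⟨GradAlg.convergesWithRate_of_pow_mul_exp_bound key, key⟩
    -- For α = 1/κ the flow decays exactly at the rate of the pole 1/q.
    · calc 1 / q * ‖y‖ ^ 2 = q ^ (k - 1) * (1 / κ * ‖y‖ ^ 2) := by
            rw [← hqκ]; field_simp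
        _ ≤ _ := by
            gcongr
            exact hs.le_inner_of_le_one ((div_le_one hκ0).2 hκ1) y
  · exact GradAlg.sectorCondition_of_strongConvexOn hμ hμL hκ (hC.differentiable f hf) h0 hc hL
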